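/- Fix $n\in\mathbb N$. Vocabularies consist of relation symbols of arbitrary finite arities, and formulas are the first-order formulas with equality in the variables $v_0,\dots,v_{n-1}$ (which may be requantified). An $m$-ary relation $D$ on the universe $A$ of a structure is *definable* in it if $m\le n$ and some formula $\varphi$ is satisfied by exactly those $(s_0,\dots,s_{n-1})\in A^n$ with $(s_0,\dots,s_{m-1})\in D$; we then say that $\varphi$ *defines* $D$. A *$U$-structure* with core $U_0$ is a relational structure with non-empty universe $A$ together with a set $U_0\subseteq A$ such that $|U_0|\ge n$, $|A\setminus U_0|\ge n$, and every basic relation $P$ (of arity $k$, say) is closed under $\sim$: if $s\in P$, $z\in A^k$, and for all $i,j<k$ we have $s_i=s_j\Leftrightarrow z_i=z_j$ and $s_i\in U_0\Leftrightarrow z_i\in U_0$, then $z\in P$. The core is not itself a basic relation. The structure is a *strong $U$-structure* if moreover, for every sub-vocabulary $W$ such that $U_0$ is not definable in the $W$-reduct, every relation $D$ definable in the $W$-reduct that consists of tuples $s\in A^m$ with pairwise distinct entries, all distinct $i,j<m$, and all $s\in A^m$: $s\in D$ if and only if $s$ has pairwise distinct entries, some tuple obtained from $s$ by changing at most the $i$-th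 entry is in $D$, and some tuple obtained from $s$ by changing at most the $j$-th entry is in $D$. The logic $\mathcal U_n$ has the formulas described above, its models are the structures that are strong $U$-structures for some core, and its satisfaction relation is that of first-order logic. **Theorem.** The logic $\mathcal U_n$ has the Beth Definability Property. That is, let $L\subseteq L^+$ be vocabularies such that $R$ is the unique symbol of $L^+$ not in $L$, and let $T^+$ be a set of $\mathcal U_n$-formulas in the vocabulary $L^+$. Suppose that $T^+$ implicitly defines $R$ over $L$: any two $\mathcal U_n$-models in the vocabulary $L^+$ in which all formulas of $T^+$ are valid, and which have the same universe and the same $L$-reduct (their cores may differ), have the same interpretation of $R$. Then $R$ is explicitly definable in $T^+$ over $L$: there is one $\mathcal U_n$-formula $\varphi$ in the vocabulary $L$ that defines the interpretation of $R$ in every $\mathcal U_n$-model, in the vocabulary $L^+$, in which all formulas of $T^+$ are valid. -/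

import Mathlib

universe u v

namespace UnLogic

/-- A vocabulary: relation symbols, each of some finite arity, and nothing else. -/
structure Vocabulary : Type (v + 1) where
  Symb : Type v
  arity : Symb → ℕ

/-- A relational structure for the vocabulary `V` with universe `A`: an interpretation of every
relation symbol of `V`. -/
abbrev RelStructure (V : Vocabulary.{v}) (A : Type u) : Type (max u v) :=
  (S : V.Symb) → Set (Fin (V.arity S) → A)

/-- First order formulas with equality in the individual variables `v_0, …, v_{n-1}`
(bound variables may be reused). -/
inductive Formula (V : Vocabulary.{v}) (n : ℕ) : Type v
  | falsum : Formula V n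
  | eq (i j : Fin n) : Formula V n
  | rel (S : V.Symb) (x : Fin (V.arity S) → Fin n) : Formula V n
  | neg (φ : Formula V n) : Formula V n
  | and (φ ψ : Formula V n) : Formula V n
  | ex (i : Fin n) (φ : Formula V n) : Formula V n

/-- The set of relation symbols that occur in a formula. -/
def Formula.voc {V : Vocabulary.{v}} {n : ℕ} : Formula V n → Set V.Symb
  | .falsum => ∅
  | .eq _ _ => ∅
  | .rel S _ => {S}
  | .neg φ => φ.voc
  | .and φ ψ => φ.voc ∪ ψ.voc
  | .ex _ φ => φ.voc

/-- Satisfaction of a formula in a structure under an assignment of the `n` variables. -/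
def Sat {V : Vocabulary.{v}} {A : Type u} {n : ℕ} (M : RelStructure V A) :
    Formula V n → (Fin n → A) → Prop
  | .falsum, _ => False
  | .eq i j, s => s i = s j
  | .rel S x, s => (fun i => s (x i)) ∈ M S
  | .neg φ, s => ¬ Sat M φ s
  | .and φ ψ, s => Sat M φ s ∧ Sat M ψ s
  | .ex i φ, s => ∃ a : A, Sat M φ (Function.update s i a)

/-- The formula `φ` defines the `m`-ary relation `D` in `M`, without parameters, by way of the
variables `v_0, …, v_{m-1}`; so `m ≤ n`, and the other variables have no influence on the truth
of `φ` in `M` (quantifying them out of `φ` does not change the relation it defines). -/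
def Defines {V : Vocabulary.{v}} {A : Type u} {n m : ℕ} (M : RelStructure V A)
    (φ : Formula V n) (D : Set (Fin m → A)) : Prop :=
  ∃ h : m ≤ n, ∀ s : Fin n → A, Sat M φ s ↔ (fun i => s (Fin.castLE h i)) ∈ D

/-- `D` is definable with `n` variables in the reduct of `M` to the sub-vocabulary `W`. -/
def DefinableIn {V : Vocabulary.{v}} {A : Type u} {m : ℕ} (n : ℕ) (M : RelStructure V A)
    (W : Set V.Symb) (D : Set (Fin m → A)) : Prop :=
  ∃ φ : Formula V n, φ.voc ⊆ W ∧ Defines M φ D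

/-- A subset of the universe, as a unary relation. -/
def unaryRel {A : Type u} (U : Set A) : Set (Fin 1 → A) := {t | t 0 ∈ U}

/-- `s ∼ z` over `U`: the two tuples have the same kernel and meet `U` at the same places. -/
def Sim {A : Type u} {k : ℕ} (U : Set A) (s z : Fin k → A) : Prop :=
  (∀ i j, s i = s j ↔ z i = z j) ∧ ∀ i, s i ∈ U ↔ z i ∈ U

/-- `M` is a `U`-structure with core `U`. -/
structure IsUStructure {V : Vocabulary.{v}} {A : Type u} (n : ℕ) (M : RelStructure V A)
    (U : Set A) : Prop where
  nonempty : Nonempty A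
  card_core : (n : ℕ∞) ≤ U.encard
  card_compl : (n : ℕ∞) ≤ Uᶜ.encard
  invariant : ∀ (S : V.Symb) (s z : Fin (V.arity S) → A), s ∈ M S → Sim U s z → z ∈ M S

/-- `M` is a strong `U`-structure with core `U`: in every reduct in which the core is not
definable, a definable relation `D` of pairwise distinct elements satisfies
`D ↔ ∃ v_i D ∧ ∃ v_j D ∧ "all entries are distinct"` for any two distinct places `i, j`. -/
structure IsStrongUStructure {V : Vocabulary.{v}} {A : Type u} (n : ℕ) (M : RelStructure V A)
    (U : Set A) : Prop extends IsUStructure n M U where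
  strong : ∀ W : Set V.Symb, ¬ DefinableIn n M W (unaryRel U) →
    ∀ (m : ℕ) (D : Set (Fin m → A)), DefinableIn n M W D → (∀ s ∈ D, Function.Injective s) →
      ∀ i j : Fin m, i ≠ j → ∀ s : Fin m → A,
        s ∈ D ↔ (∃ a, Function.update s i a ∈ D) ∧ (∃ a, Function.update s j a ∈ D) ∧
          Function.Injective s

/-- `M` is a model of the logic `𝒰_n`: a strong `U`-structure for some core. The core is not
a basic relation. -/
def IsUnModel {V : Vocabulary.{v}} {A : Type u} (n : ℕ) (M : RelStructure V A) : Prop :=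
  ∃ U : Set A, IsStrongUStructure n M U

/-- `M` is a model, in the sense of `𝒰_n`, of the theory `T`: all formulas of `T` are valid
in it. -/
def ModelsTheory {V : Vocabulary.{v}} {A : Type u} {n : ℕ} (M : RelStructure V A)
    (T : Set (Formula V n)) : Prop :=
  IsUnModel n M ∧ ∀ φ ∈ T, ∀ s : Fin n → A, Sat M φ s

/-- `T` implicitly defines, over the sub-vocabulary `L`, the remaining symbols: models of `T` with
the same universe and the same `L`-reduct are the same. -/
def ImplicitlyDefines {V : Vocabulary.{v}} {n : ℕ} (T : Set (Formula V n))
    (L : Set V.Symb) : Prop :=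
  ∀ (A : Type u) (M N : RelStructure V A), ModelsTheory M T → ModelsTheory N T →
    (∀ S ∈ L, M S = N S) → M = N

/-- `R` can be explicitly defined in `T` over `L`: one formula in the vocabulary `L` defines `R`
in every model of `T`. -/
def ExplicitlyDefinable {V : Vocabulary.{v}} {n : ℕ} (T : Set (Formula V n))
    (L : Set V.Symb) (R : V.Symb) : Prop :=
  ∃ φ : Formula V n, φ.voc ⊆ L ∧
    ∀ (A : Type u) (M : RelStructure V A), ModelsTheory M T → Defines M φ (M R)

/-- The logic `𝒰_n` has the Beth Definability Property. The vocabulary `V` is `L⁺`; `L` is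
a sub-vocabulary, and `R` is the unique symbol of `V` that does not belong to `L`. -/
def BethDefinabilityProperty (n : ℕ) : Prop :=
  ∀ (V : Vocabulary.{v}) (L : Set V.Symb) (R : V.Symb), (∀ S : V.Symb, S ∉ L ↔ S = R) →
    ∀ T : Set (Formula V n), ImplicitlyDefines.{u} T L → ExplicitlyDefinable.{u} T L R

end UnLogic

/-!
The truth of an `n`-variable formula in a `U`-structure depends only on the similarity type of the
assignment (`Matches.sat_iff`): the core and its complement are so large that the existential
quantifier can always be matched by a back-and-forth step. So every model can be replaced by one
over a fixed universe `Base` with a fixed core, and the values of basic relations at tuples with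
more than `n` distinct entries, which no formula sees, can be dropped (`normalModel_normalize`).
A normal model interprets each symbol by one of finitely many relations. Hence an ultrafilter limit
of normal models agrees with a member of the family on any given finite set of symbols, and this
gives a compactness theorem (`NormalModel.compactness`).

If the core is not definable over `L`, then the strong `U`-structure condition collapses every
relation of pairwise distinct elements that is definable over `L`, so that formulas over `L` see
only the kernel of a tuple (`IsStrongUStructure.elemEquiv_of_kernel_eq`). If it is definable, they
see the whole similarity type, except that two equivalent models may exchange the roles of the core
and its complement.

Suppose now that `s` in `M` and `t` in `N` satisfy the same formulas over `L`. In either case some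
permutation of `Base` takes the `L`-reduct of `M` to that of `N`, and takes `s` to `t` up to
similarity. The image of `M` is a model of the theory, with a possibly different core, so implicit
definability makes it equal to `N`, and `s` and `t` satisfy the same formulas over the full
vocabulary (`NormalModel.sat_iff_of_elemEquiv`). Two applications of compactness turn this into a
single defining formula (`exists_formula_iff`). A symbol of arity above `n` is never implicitly
defined by a theory that has models (`not_modelsTheory_of_lt_arity`).
-/

universe w

namespace UnLogic

open Function Filter

/-! ### Similarity of tuples over different universes -/

/-- The relation `Sim` between tuples that may come from two universes `A` and `B`, each with its
own core; `Sim U` is `CrossSim U U`. -/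
def CrossSim {A : Type u} {B : Type w} {k : ℕ} (U : Set A) (U' : Set B) (s : Fin k → A)
    (x : Fin k → B) : Prop :=
  (∀ i j, s i = s j ↔ x i = x j) ∧ ∀ i, s i ∈ U ↔ x i ∈ U'

/-- Both the core and its complement have at least `n` elements. -/
structure Spacious {A : Type u} (n : ℕ) (U : Set A) : Prop where
  card_core : (n : ℕ∞) ≤ U.encard
  card_compl : (n : ℕ∞) ≤ Uᶜ.encard

section CrossSim

variable {A : Type u} {B : Type w} {U : Set A} {U' : Set B} {k l n : ℕ}

theorem Spacious.mono (h : Spacious n U) (hk : k ≤ n) : Spacious k U :=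
  ⟨le_trans (by exact_mod_cast hk) h.card_core, le_trans (by exact_mod_cast hk) h.card_compl⟩

theorem CrossSim.symm {s : Fin k → A} {x : Fin k → B} (h : CrossSim U U' s x) :
    CrossSim U' U x s :=
  ⟨fun i j => (h.1 i j).symm, fun i => (h.2 i).symm⟩

theorem CrossSim.trans {C : Type*} {U'' : Set C} {s : Fin k → A} {x : Fin k → B} {y : Fin k → C}
    (h : CrossSim U U' s x) (h' : CrossSim U' U'' x y) : CrossSim U U'' s y :=
  ⟨fun i j => (h.1 i j).trans (h'.1 i j), fun i => (h.2 i).trans (h'.2 i)⟩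

theorem CrossSim.comp {s : Fin k → A} {x : Fin k → B} (h : CrossSim U U' s x)
    (f : Fin l → Fin k) : CrossSim U U' (fun i => s (f i)) (fun i => x (f i)) :=
  ⟨fun i j => h.1 (f i) (f j), fun i => h.2 (f i)⟩

theorem CrossSim.injective {s : Fin k → A} {x : Fin k → B} (h : CrossSim U U' s x)
    (hs : Injective s) : Injective x :=
  fun i j hij => hs ((h.1 i j).2 hij)

theorem CrossSim.update {s : Fin k → A} {x : Fin k → B} (h : CrossSim U U' s x) (i : Fin k)
    {a : A} {b : B} (hab : ∀ j, j ≠ i → (s j = a ↔ x j = b)) (hc : a ∈ U ↔ b ∈ U') :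
    CrossSim U U' (update s i a) (update x i b) := by
  refine ⟨fun p q => ?_, fun p => ?_⟩
  · by_cases hp : p = i <;> by_cases hq : q = i
    · subst hp; subst hq; simp
    · subst hp
      simpa [update_of_ne hq, eq_comm] using hab q hq
    · subst hq
      simpa [update_of_ne hp] using hab p hp
    · simpa [update_of_ne hp, update_of_ne hq] using h.1 p q
  · by_cases hp : p = i
    · subst hp; simpa using hc
    · simpa [update_of_ne hp] using h.2 p

theorem exists_fresh (h : (k : ℕ∞) ≤ U.encard) (i : Fin k) (s : Fin k → A) :
    ∃ a ∈ U, ∀ j, j ≠ i → s j ≠ a := by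
  by_contra! hcon
  have hsub : U ⊆ s '' ({i}ᶜ : Set (Fin k)) := by
    intro a ha
    obtain ⟨j, hj, rfl⟩ := hcon a ha
    exact ⟨j, hj, rfl⟩
  have h1 := h.trans ((Set.encard_le_encard hsub).trans (Set.encard_image_le _ _))
  rw [← Set.Finite.cast_ncard_eq (Set.toFinite _), Set.ncard_compl, Set.ncard_singleton,
    Nat.card_eq_fintype_card, Fintype.card_fin] at h1
  have h2 : k ≤ k - 1 := by exact_mod_cast h1
  have := i.pos
  omega

/-- The back-and-forth step. An entry that is not a repetition is matched by a fresh element on the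
same side of the core, and `k` elements on each side suffice for that. -/
theorem CrossSim.extend (hU' : Spacious k U') {s : Fin k → A} {x : Fin k → B}
    (h : CrossSim U U' s x) (i : Fin k) (a : A) :
    ∃ b, CrossSim U U' (Function.update s i a) (Function.update x i b) := by
  by_cases hex : ∃ j, j ≠ i ∧ s j = a
  · obtain ⟨j, -, rfl⟩ := hex
    exact ⟨x j, h.update i (fun p _ => h.1 p j) (h.2 j)⟩
  · push Not at hex
    by_cases ha : a ∈ U
    · obtain ⟨b, hb, hfr⟩ := exists_fresh hU'.card_core i x
      exact ⟨b, h.update i (fun j hj => iff_of_false (hex j hj) (hfr j hj)) (iff_of_true ha hb)⟩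
    · obtain ⟨b, hb, hfr⟩ := exists_fresh hU'.card_compl i x
      exact ⟨b, h.update i (fun j hj => iff_of_false (hex j hj) (hfr j hj)) (iff_of_false ha hb)⟩

/-- Every tuple has a similar one over the other universe: starting from similar constant tuples,
change the entries one at a time. -/
theorem exists_crossSim (hU : Spacious k U) (hU' : Spacious k U') (s : Fin k → A) :
    ∃ x, CrossSim U U' s x := by
  have base : ∃ (s₀ : Fin k → A) (x : Fin k → B), CrossSim U U' s₀ x := by
    rcases Nat.eq_zero_or_pos k with rfl | hk
    · exact ⟨Fin.elim0, Fin.elim0, fun i => i.elim0, fun i => i.elim0⟩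
    · obtain ⟨a, ha, -⟩ := exists_fresh hU.card_core ⟨0, hk⟩ s
      have : U'.Nonempty := by
        rw [← Set.one_le_encard_iff_nonempty]
        exact le_trans (by exact_mod_cast hk) hU'.card_core
      obtain ⟨b, hb⟩ := this
      exact ⟨fun _ => a, fun _ => b, fun _ _ => by simp, fun _ => iff_of_true ha hb⟩
  have step : ∀ J : Finset (Fin k), ∃ (s' : Fin k → A) (x : Fin k → B),
      CrossSim U U' s' x ∧ ∀ j ∈ J, s' j = s j := by
    intro J
    induction J using Finset.induction_on with
    | empty => obtain ⟨s₀, x, h⟩ := base; exact ⟨s₀, x, h, by simp⟩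
    | insert i J _ ih =>
      obtain ⟨s', x, h, hJ⟩ := ih
      obtain ⟨b, hb⟩ := h.extend hU' i (s i)
      refine ⟨_, _, hb, fun j hj => ?_⟩
      by_cases hji : j = i
      · subst hji; simp
      · rw [update_of_ne hji]
        exact hJ j ((Finset.mem_insert.1 hj).resolve_left hji)
  obtain ⟨s', x, h, hs⟩ := step Finset.univ
  obtain rfl : s' = s := funext fun j => hs j (Finset.mem_univ j)
  exact ⟨x, h⟩

/-- The similarity type of a tuple: its kernel and the set of places where it meets the core. -/
def simType (U : Set A) (s : Fin k → A) : Set (Fin k × Fin k) × Set (Fin k) :=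
  ({p | s p.1 = s p.2}, {i | s i ∈ U})

theorem simType_eq_iff {s z : Fin k → A} : simType U s = simType U z ↔ Sim U s z := by
  simp [simType, Sim, Prod.ext_iff, Set.ext_iff]

end CrossSim

/-! ### Transfer between structures -/

section Transfer

variable {V : Vocabulary.{v}} {A : Type u} {B : Type w} {n : ℕ} {U : Set A} {U' : Set B}
  {M : RelStructure V A} {N : RelStructure V B}

theorem IsUStructure.spacious (h : IsUStructure n M U) : Spacious n U := ⟨h.card_core, h.card_compl⟩

/-- `M` and `N` agree, up to similarity, on those tuples that can be addressed with the `n`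
variables. For a symbol whose arity is above `n` this leaves its value free at the tuples with
more than `n` distinct entries. -/
def Matches (n : ℕ) (U : Set A) (U' : Set B) (M : RelStructure V A) (N : RelStructure V B) : Prop :=
  ∀ (S : V.Symb) (f : Fin (V.arity S) → Fin n) (s : Fin n → A) (x : Fin n → B),
    CrossSim U U' s x → ((fun i => s (f i)) ∈ M S ↔ (fun i => x (f i)) ∈ N S)

/-- Matching structures satisfy the same formulas at similar tuples. -/
theorem Matches.sat_iff (hU : Spacious n U) (hU' : Spacious n U') (H : Matches n U U' M N)
    (φ : Formula V n) : ∀ (s : Fin n → A) (x : Fin n → B), CrossSim U U' s x →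
      (Sat M φ s ↔ Sat N φ x) := by
  induction φ with
  | falsum => exact fun _ _ _ => Iff.rfl
  | eq i j => exact fun _ _ h => h.1 i j
  | rel S f => exact H S f
  | neg φ ih => intro s x h; exact not_congr (ih s x h)
  | and φ ψ ih ih' => intro s x h; exact and_congr (ih s x h) (ih' s x h)
  | ex i φ ih =>
    intro s x h
    constructor
    · rintro ⟨a, ha⟩
      obtain ⟨b, hb⟩ := h.extend hU' i a
      exact ⟨b, (ih _ _ hb).1 ha⟩
    · rintro ⟨b, hb⟩
      obtain ⟨a, ha⟩ := h.symm.extend hU i b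
      exact ⟨a, (ih _ _ ha.symm).2 hb⟩

theorem IsUStructure.matches_self (h : IsUStructure n M U) : Matches n U U M M :=
  fun S f _ _ hs => ⟨fun hm => h.invariant S _ _ hm (hs.comp f),
    fun hm => h.invariant S _ _ hm (hs.comp f).symm⟩

theorem IsUStructure.sat_iff_of_sim (h : IsUStructure n M U) (φ : Formula V n) {s z : Fin n → A}
    (hs : Sim U s z) : Sat M φ s ↔ Sat M φ z :=
  h.matches_self.sat_iff h.spacious h.spacious φ s z hs

/-- Being a strong `U`-structure only concerns what `n` variables can express, so it passes to
any matching `U`-structure. -/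
theorem IsStrongUStructure.transfer (hM : IsStrongUStructure n M U) (hN : IsUStructure n N U')
    (H : Matches n U U' M N) : IsStrongUStructure n N U' := by
  have hU := hM.spacious
  have hU' := hN.spacious
  have hsat := H.sat_iff hU hU'
  refine ⟨hN, fun W hW m D hD hinj i j hij x => ?_⟩
  obtain ⟨φ, hφW, hmn, hφ⟩ := hD
  have hW' : ¬ DefinableIn n M W (unaryRel U) := by
    rintro ⟨υ, hυW, h1, hυ⟩
    refine hW ⟨υ, hυW, h1, fun y => ?_⟩
    obtain ⟨s, hs⟩ := exists_crossSim hU' hU y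
    rw [← hsat υ s y hs.symm, hυ]
    exact hs.symm.2 _
  have : Nonempty (Fin m) := ⟨i⟩
  -- `r` extends an `m`-tuple to an assignment of all `n` variables.
  obtain ⟨r, hr⟩ := (Fin.castLE_injective hmn).hasLeftInverse
  have hUm := hU.mono hmn
  have hUm' := hU'.mono hmn
  let E : Set (Fin m → A) := {z | Sat M φ (fun p => z (r p))}
  have hDr : ∀ y : Fin m → B, Sat N φ (fun p => y (r p)) ↔ y ∈ D := by
    intro y
    rw [hφ]
    simp only [hr _]
  have key : ∀ (z : Fin m → A) (y : Fin m → B), CrossSim U U' z y → (z ∈ E ↔ y ∈ D) := by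
    intro z y h
    rw [← hDr]
    exact hsat φ _ _ (h.comp r)
  have hE : DefinableIn n M W E := by
    refine ⟨φ, hφW, hmn, fun s => ?_⟩
    obtain ⟨y, hy⟩ := exists_crossSim hU hU' s
    rw [hsat φ s y hy, hφ y]
    exact (key _ _ (hy.comp _)).symm
  have hEinj : ∀ z ∈ E, Injective z := by
    intro z hz
    obtain ⟨y, hy⟩ := exists_crossSim hUm hUm' z
    exact hy.symm.injective (hinj y ((key z y hy).1 hz))
  obtain ⟨z, hz⟩ := exists_crossSim hUm' hUm x
  have hup : ∀ p, (∃ a, update z p a ∈ E) ↔ ∃ b, update x p b ∈ D := by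
    intro p
    constructor
    · rintro ⟨a, ha⟩
      obtain ⟨b, hb⟩ := hz.symm.extend hUm' p a
      exact ⟨b, (key _ _ hb).1 ha⟩
    · rintro ⟨b, hb⟩
      obtain ⟨a, ha⟩ := hz.extend hUm p b
      exact ⟨a, (key _ _ ha.symm).2 hb⟩
  rw [← key z x hz.symm, hM.strong W hW' m E hE hEinj i j hij z, hup, hup]
  exact and_congr_right fun _ => and_congr_right fun _ => ⟨hz.symm.injective, hz.injective⟩

theorem Matches.valid_iff (hU : Spacious n U) (hU' : Spacious n U') (H : Matches n U U' M N)
    (φ : Formula V n) : (∀ s, Sat M φ s) ↔ ∀ x, Sat N φ x := by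
  constructor
  · intro h x
    obtain ⟨s, hs⟩ := exists_crossSim hU' hU x
    exact (H.sat_iff hU hU' φ s x hs.symm).1 (h s)
  · intro h s
    obtain ⟨x, hx⟩ := exists_crossSim hU hU' s
    exact (H.sat_iff hU hU' φ s x hx).2 (h x)

theorem sat_congr_of_voc {M M' : RelStructure V A} (φ : Formula V n)
    (h : ∀ S ∈ φ.voc, M S = M' S) : ∀ s, Sat M φ s ↔ Sat M' φ s := by
  induction φ with
  | falsum => intro s; exact Iff.rfl
  | eq i j => intro s; exact Iff.rfl
  | rel S f => intro s; simp only [Sat, h S rfl]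
  | neg φ ih => intro s; exact not_congr (ih h s)
  | and φ ψ ih ih' =>
    intro s
    exact and_congr (ih (fun S hS => h S (Or.inl hS)) s) (ih' (fun S hS => h S (Or.inr hS)) s)
  | ex i φ ih => intro s; exact exists_congr fun a => ih h _

theorem Formula.finite_voc (φ : Formula V n) : φ.voc.Finite := by
  induction φ with
  | falsum => exact Set.finite_empty
  | eq i j => exact Set.finite_empty
  | rel S f => exact Set.finite_singleton S
  | neg φ ih => exact ih
  | and φ ψ ih ih' => exact ih.union ih'
  | ex i φ ih => exact ih

end Transfer

/-! ### Normal models over a fixed base -/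

/-- A universe with an infinite and coinfinite core, on which every model can be represented. -/
abbrev Base : Type u := ULift.{u} (ℕ × Bool)

/-- The core of `Base`: the elements of colour `true`. -/
def core : Set Base.{u} := {a | a.down.2 = true}

/-- Exchange of the core of `Base` with its complement. -/
def colourSwap : Equiv.Perm Base.{u} where
  toFun a := ⟨(a.down.1, !a.down.2)⟩
  invFun a := ⟨(a.down.1, !a.down.2)⟩
  left_inv a := by simp
  right_inv a := by simp

theorem colourSwap_mem_core (a : Base.{u}) : colourSwap a ∈ core ↔ a ∉ core := by
  simp [colourSwap, core]

theorem spacious_core (n : ℕ) : Spacious n core.{u} := by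
  have h1 : core.{u}.Infinite := by
    refine Set.infinite_of_injective_forall_mem (f := fun k : ℕ => ⟨(k, true)⟩) ?_ ?_
    · intro a b h; simpa using h
    · intro a; simp [core]
  have h2 : core.{u}ᶜ.Infinite := by
    refine Set.infinite_of_injective_forall_mem (f := fun k : ℕ => ⟨(k, false)⟩) ?_ ?_
    · intro a b h; simpa using h
    · intro a; simp [core]
  constructor
  · rw [h1.encard_eq]; exact le_top
  · rw [h2.encard_eq]; exact le_top

/-- The tuple `x` factors through `Fin n`, that is, has at most `n` distinct entries. -/
def FewValues {A : Type u} {k : ℕ} (n : ℕ) (x : Fin k → A) : Prop :=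
  ∃ f : Fin k → Fin n, ∀ i j, f i = f j → x i = x j

theorem fewValues_comp {A : Type u} {k n : ℕ} (y : Fin n → A) (f : Fin k → Fin n) :
    FewValues n (fun i => y (f i)) :=
  ⟨f, fun i j h => by simp only [h]⟩

/-- `A` is nonempty so that the values outside the range of `f` can be chosen. -/
theorem FewValues.exists_eq_comp {A : Type u} [Nonempty A] {k n : ℕ} {x : Fin k → A}
    (h : FewValues n x) : ∃ (f : Fin k → Fin n) (y : Fin n → A), x = fun i => y (f i) := by
  obtain ⟨f, hf⟩ := h
  refine ⟨f, Function.extend f x (fun _ => Classical.arbitrary A), funext fun i => ?_⟩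
  exact (FactorsThrough.extend_apply (f := f) (g := x) (fun i j hij => hf i j hij) _ i).symm

section Normal

variable {V : Vocabulary.{v}} {n : ℕ}

/-- The structure on `Base` with the same similarity types of tuples as `M`, as far as these are
types of tuples with at most `n` distinct entries; the other tuples are dropped. -/
def normalize {A : Type u} (n : ℕ) (M : RelStructure V A) (U : Set A) :
    RelStructure V Base.{u} :=
  fun _ => {x | FewValues n x ∧ ∃ z ∈ M _, CrossSim U core z x}

/-- A strong `U`-structure on `Base` with the standard core in which `T` is valid and in which no
basic relation contains a tuple with more than `n` distinct entries. -/
structure NormalModel (T : Set (Formula V n)) (N : RelStructure V Base.{u}) : Prop where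
  strong : IsStrongUStructure n N core
  few : ∀ S, ∀ x ∈ N S, FewValues n x
  valid : ∀ φ ∈ T, ∀ s, Sat N φ s

theorem NormalModel.modelsTheory {T : Set (Formula V n)} {N : RelStructure V Base.{u}}
    (h : NormalModel T N) : ModelsTheory N T :=
  ⟨⟨core, h.strong⟩, h.valid⟩

theorem matches_normalize {A : Type u} {M : RelStructure V A} {U : Set A}
    (hM : IsUStructure n M U) : Matches n U core M (normalize n M U) := by
  intro S f s x h
  constructor
  · intro hs
    exact ⟨fewValues_comp x f, _, hs, h.comp f⟩
  · rintro ⟨-, z, hz, hzx⟩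
    exact hM.invariant S _ _ hz (hzx.trans (h.comp f).symm)

theorem isUStructure_normalize {A : Type u} (M : RelStructure V A) (U : Set A) :
    IsUStructure n (normalize n M U) core := by
  refine ⟨⟨⟨(0, true)⟩⟩, (spacious_core n).1, (spacious_core n).2, ?_⟩
  rintro S s z ⟨⟨f, hf⟩, y, hy, hys⟩ hsz
  exact ⟨⟨f, fun i j h => (hsz.1 i j).1 (hf i j h)⟩, y, hy, CrossSim.trans hys hsz⟩

theorem normalModel_normalize {A : Type u} {M : RelStructure V A} {U : Set A}
    {T : Set (Formula V n)} (hM : IsStrongUStructure n M U) (hT : ∀ φ ∈ T, ∀ s, Sat M φ s) :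
    NormalModel T (normalize n M U) where
  strong := hM.transfer (isUStructure_normalize M U) (matches_normalize hM.toIsUStructure)
  few := fun _ _ hx => hx.1
  valid := fun φ hφ => ((matches_normalize hM.toIsUStructure).valid_iff hM.spacious
    (spacious_core n) φ).1 (hT φ hφ)

end Normal

/-! ### Compactness for normal models -/

section Compactness

variable {V : Vocabulary.{v}} {n : ℕ}

theorem exists_eventually_eq {ι τ : Type*} [Finite τ] (F : Ultrafilter ι) (g : ι → τ) :
    ∃ t, ∀ᶠ i in F, g i = t := by
  by_contra h
  rw [not_exists] at h
  have h' : ∀ᶠ i in F, ∀ t, g i ≠ t :=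
    eventually_all.2 fun t => Ultrafilter.eventually_not.2 (h t)
  obtain ⟨i, hi⟩ := h'.exists
  exact hi _ rfl

/-- A basic relation of a normal model is determined by a set of similarity types, for which there
are finitely many choices; so it stabilizes along an ultrafilter. -/
theorem exists_eventually_interpretation_eq {ι : Type*} (F : Ultrafilter ι)
    {N : ι → RelStructure V Base.{u}} (hN : ∀ i, IsUStructure n (N i) core) (S : V.Symb) :
    ∃ X, ∀ᶠ i in F, N i S = X := by
  obtain ⟨t, ht⟩ := exists_eventually_eq F fun i => simType core '' N i S
  obtain ⟨i₀, h₀⟩ := ht.exists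
  have hmem : ∀ i x, x ∈ N i S ↔ simType core x ∈ simType core '' N i S := by
    refine fun i x => ⟨fun h => ⟨x, h, rfl⟩, ?_⟩
    rintro ⟨z, hz, hzx⟩
    exact (hN i).invariant S z x hz (simType_eq_iff.1 hzx)
  refine ⟨N i₀ S, ht.mono fun i hi => Set.ext fun x => ?_⟩
  rw [hmem, hmem, hi, h₀]

/-- A structure that agrees with some member of a family of normal models on every finite set of
symbols is a normal model. Only the symbols that occur in a formula matter for the strong
`U`-structure condition on the relation it defines. -/
theorem NormalModel.of_finite_agreement {T : Set (Formula V n)} {N : RelStructure V Base.{u}}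
    (h : ∀ W : Set V.Symb, W.Finite → ∃ N', NormalModel T N' ∧ ∀ S ∈ W, N' S = N S) :
    NormalModel T N where
  strong := by
    refine ⟨⟨⟨⟨(0, true)⟩⟩, (spacious_core n).1, (spacious_core n).2, fun S => ?_⟩, ?_⟩
    · obtain ⟨N', hN', hS⟩ := h {S} (Set.finite_singleton S)
      rw [← hS S rfl]
      exact hN'.strong.invariant S
    · rintro W hW m D ⟨φ, hφW, hφ⟩
      obtain ⟨N', hN', hS⟩ := h φ.voc φ.finite_voc
      refine hN'.strong.strong φ.voc ?_ m D ⟨φ, subset_rfl, ?_⟩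
      · rintro ⟨υ, hυ, h1, hdef⟩
        refine hW ⟨υ, hυ.trans hφW, h1, fun s => ?_⟩
        rw [← hdef, sat_congr_of_voc υ fun S hS' => hS S (hυ hS')]
      · obtain ⟨hm, hdef⟩ := hφ
        exact ⟨hm, fun s => by rw [← hdef, sat_congr_of_voc φ hS]⟩
  few := fun S => by
    obtain ⟨N', hN', hS⟩ := h {S} (Set.finite_singleton S)
    rw [← hS S rfl]
    exact hN'.few S
  valid := fun φ hφ s => by
    obtain ⟨N', hN', hS⟩ := h φ.voc φ.finite_voc
    rw [← sat_congr_of_voc φ hS]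
    exact hN'.valid φ hφ s

/-- Compactness: a set of formulas is satisfiable in a normal model if its finite subsets are. -/
theorem NormalModel.compactness {T Γ : Set (Formula V n)}
    (h : ∀ Γ₀ : Set (Formula V n), Γ₀.Finite → Γ₀ ⊆ Γ →
      ∃ N : RelStructure V Base.{u}, NormalModel T N ∧ ∃ s, ∀ γ ∈ Γ₀, Sat N γ s) :
    ∃ N : RelStructure V Base.{u}, NormalModel T N ∧ ∃ s, ∀ γ ∈ Γ, Sat N γ s := by
  classical
  have h' : ∀ Γ₀ : Finset Γ, ∃ N : RelStructure V Base.{u}, NormalModel T N ∧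
      ∃ s, ∀ γ ∈ Γ₀, Sat N γ.1 s := by
    intro Γ₀
    obtain ⟨N, hN, s, hs⟩ := h (Subtype.val '' (Γ₀ : Set Γ)) (Γ₀.finite_toSet.image _)
      (by rintro _ ⟨γ, -, rfl⟩; exact γ.2)
    exact ⟨N, hN, s, fun γ hγ => hs _ ⟨γ, hγ, rfl⟩⟩
  choose N hN s hs using h'
  let F : Ultrafilter (Finset Γ) := Ultrafilter.of atTop
  have hF : ∀ γ : Γ, ∀ᶠ i : Finset Γ in F, γ ∈ i := fun γ =>
    Ultrafilter.of_le atTop ((eventually_ge_atTop {γ}).mono fun _ hi =>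
      Finset.singleton_subset_iff.1 hi)
  choose L hL using exists_eventually_interpretation_eq F fun i => (hN i).strong.toIsUStructure
  have hfin : ∀ W : Set V.Symb, W.Finite → ∀ᶠ i in F, ∀ S ∈ W, N i S = L S := fun W hW =>
    (eventually_all_finite hW).2 fun S _ => hL S
  have hlim : NormalModel T L := NormalModel.of_finite_agreement fun W hW => by
    obtain ⟨i, hi⟩ := (hfin W hW).exists
    exact ⟨N i, hN i, hi⟩
  obtain ⟨t, ht⟩ := exists_eventually_eq F fun i => simType core (s i)
  obtain ⟨i₀, h₀⟩ := ht.exists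
  refine ⟨L, hlim, s i₀, fun γ hγ => ?_⟩
  obtain ⟨i, h1, h2, h3⟩ := ((hF ⟨γ, hγ⟩).and (ht.and (hfin γ.voc γ.finite_voc))).exists
  rw [hlim.strong.sat_iff_of_sim γ (simType_eq_iff.1 (h₀.trans h2.symm)),
    ← sat_congr_of_voc γ h3]
  exact hs i ⟨γ, hγ⟩ h1

end Compactness

/-! ### Formulas with prescribed meaning -/

section Formulas

variable {V : Vocabulary.{v}} {n : ℕ} {L : Set V.Symb}

theorem exists_conj {ι : Type*} [Finite ι] (F : ι → Formula V n) (hF : ∀ i, (F i).voc ⊆ L) :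
    ∃ ψ : Formula V n, ψ.voc ⊆ L ∧ ∀ (A : Type u) (M : RelStructure V A) (s : Fin n → A),
      Sat M ψ s ↔ ∀ i, Sat M (F i) s := by
  classical
  have := Fintype.ofFinite ι
  have key : ∀ J : Finset ι, ∃ ψ : Formula V n, ψ.voc ⊆ L ∧
      ∀ (A : Type u) (M : RelStructure V A) (s : Fin n → A),
        Sat M ψ s ↔ ∀ i ∈ J, Sat M (F i) s := by
    intro J
    induction J using Finset.induction_on with
    | empty => exact ⟨.neg .falsum, Set.empty_subset _, fun A M s => by simp [Sat]⟩
    | insert i J _ ih =>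
      obtain ⟨ψ, hψ, h⟩ := ih
      exact ⟨.and (F i) ψ, Set.union_subset (hF i) hψ, fun A M s => by
        simp [Sat, h]⟩
  obtain ⟨ψ, hψ, h⟩ := key Finset.univ
  exact ⟨ψ, hψ, fun A M s => by simp [h]⟩

theorem exists_disj {ι : Type*} [Finite ι] (F : ι → Formula V n) (hF : ∀ i, (F i).voc ⊆ L) :
    ∃ ψ : Formula V n, ψ.voc ⊆ L ∧ ∀ (A : Type u) (M : RelStructure V A) (s : Fin n → A),
      Sat M ψ s ↔ ∃ i, Sat M (F i) s := by
  obtain ⟨ψ, hψ, h⟩ := exists_conj.{u} (fun i => .neg (F i)) hF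
  exact ⟨.neg ψ, hψ, fun A M s => by simp [Sat, h]⟩

theorem exists_exists (J : Finset (Fin n)) (φ : Formula V n) (hφ : φ.voc ⊆ L) :
    ∃ ψ : Formula V n, ψ.voc ⊆ L ∧ ∀ (A : Type u) (M : RelStructure V A) (s : Fin n → A),
      Sat M ψ s ↔ ∃ z, (∀ i, i ∉ J → z i = s i) ∧ Sat M φ z := by
  induction J using Finset.induction_on with
  | empty =>
    refine ⟨φ, hφ, fun A M s => ⟨fun h => ⟨s, fun _ _ => rfl, h⟩, ?_⟩⟩
    rintro ⟨z, hz, h⟩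
    rwa [← show z = s from funext fun i => hz i (Finset.notMem_empty i)]
  | insert j J _ ih =>
    obtain ⟨ψ, hψ, h⟩ := ih
    refine ⟨.ex j ψ, hψ, fun A M s => ?_⟩
    simp only [Sat, h]
    constructor
    · rintro ⟨a, z, hz, hs⟩
      refine ⟨z, fun i hi => ?_, hs⟩
      rw [Finset.mem_insert, not_or] at hi
      rw [hz i hi.2, update_of_ne hi.1]
    · rintro ⟨z, hz, hs⟩
      refine ⟨z j, z, fun i hi => ?_, hs⟩
      by_cases hij : i = j
      · subst hij; simp
      · rw [update_of_ne hij]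
        exact hz i (by simp [hij, hi])

/-- Substitution of variables along an idempotent map `f`: the variables that `f` moves are
identified with their images and then quantified out. -/
theorem exists_subst (f : Fin n → Fin n) (hf : ∀ i, f (f i) = f i) (φ : Formula V n)
    (hφ : φ.voc ⊆ L) :
    ∃ ψ : Formula V n, ψ.voc ⊆ L ∧ ∀ (A : Type u) (M : RelStructure V A) (s : Fin n → A),
      Sat M ψ s ↔ Sat M φ fun i => s (f i) := by
  classical
  obtain ⟨ε, hε, h⟩ := exists_conj.{u} (L := L) (fun i : Fin n => Formula.eq (V := V) i (f i))
    (fun _ => Set.empty_subset _)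
  obtain ⟨ψ, hψ, h'⟩ := exists_exists.{u} (Finset.univ.filter fun i => f i ≠ i) (.and ε φ)
    (Set.union_subset hε hφ)
  refine ⟨ψ, hψ, fun A M s => ?_⟩
  simp only [h', Sat, h, Finset.mem_filter, Finset.mem_univ, true_and, not_not]
  constructor
  · rintro ⟨z, hz, he, hs⟩
    rwa [← show z = fun i => s (f i) from funext fun i => by rw [he i, hz (f i) (hf i)]]
  · intro hs
    exact ⟨fun i => s (f i), fun i hi => congrArg s hi,
      fun i => congrArg s (hf i).symm, hs⟩

/-- Renaming of all variables, free and bound, by a permutation. -/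
def Formula.rename (π : Equiv.Perm (Fin n)) : Formula V n → Formula V n
  | .falsum => .falsum
  | .eq i j => .eq (π i) (π j)
  | .rel S x => .rel S fun i => π (x i)
  | .neg φ => .neg (φ.rename π)
  | .and φ ψ => .and (φ.rename π) (ψ.rename π)
  | .ex i φ => .ex (π i) (φ.rename π)

theorem Formula.voc_rename (π : Equiv.Perm (Fin n)) (φ : Formula V n) :
    (φ.rename π).voc = φ.voc := by
  induction φ <;> simp_all [Formula.rename, Formula.voc]

theorem sat_rename {A : Type u} (M : RelStructure V A) (π : Equiv.Perm (Fin n))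
    (φ : Formula V n) : ∀ s, Sat M (φ.rename π) s ↔ Sat M φ fun i => s (π i) := by
  induction φ with
  | falsum => intro s; exact Iff.rfl
  | eq i j => intro s; exact Iff.rfl
  | rel S x => intro s; exact Iff.rfl
  | neg φ ih => intro s; exact not_congr (ih s)
  | and φ ψ ih ih' => intro s; exact and_congr (ih s) (ih' s)
  | ex i φ ih =>
    intro s
    refine exists_congr fun a => ?_
    rw [ih, show (fun j => update s (π i) a (π j)) = update (fun j => s (π j)) i a from
      update_comp_eq_of_injective s π.injective i a]

end Formulas

/-! ### Equivalence of tuples with respect to a sub-vocabulary -/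

section ElemEquiv

variable {V : Vocabulary.{v}} {n : ℕ} {L : Set V.Symb} {A : Type u}
  {M N P : RelStructure V A} {s t r : Fin n → A}

/-- The tuple `s` satisfies in `M` the same formulas over `L` as `t` does in `N`. -/
def ElemEquiv (L : Set V.Symb) (M N : RelStructure V A) (s t : Fin n → A) : Prop :=
  ∀ φ : Formula V n, φ.voc ⊆ L → (Sat M φ s ↔ Sat N φ t)

theorem ElemEquiv.symm (h : ElemEquiv L M N s t) : ElemEquiv L N M t s :=
  fun φ hφ => (h φ hφ).symm

theorem ElemEquiv.trans (h : ElemEquiv L M N s t) (h' : ElemEquiv L N P t r) :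
    ElemEquiv L M P s r :=
  fun φ hφ => (h φ hφ).trans (h' φ hφ)

theorem ElemEquiv.eq_iff (h : ElemEquiv L M N s t) (i j : Fin n) : s i = s j ↔ t i = t j :=
  h (.eq i j) (Set.empty_subset _)

/-- Equivalence passes to the constant tuples of entries: all variables can be replaced by `v_i`. -/
theorem ElemEquiv.const (h : ElemEquiv L M N s t) (i : Fin n) :
    ElemEquiv L M N (fun _ : Fin n => s i) (fun _ => t i) := by
  intro φ hφ
  obtain ⟨ψ, hψ, hs⟩ := exists_subst.{u} (fun _ => i) (fun _ => rfl) φ hφ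
  rw [← hs A M s, ← hs A N t]
  exact h ψ hψ

/-- If some tuples are equivalent, then every tuple has an equivalent partner: there are only
finitely many similarity types of possible partners, so finitely many formulas would exclude them
all, and their conjunction can be quantified existentially. -/
theorem ElemEquiv.exists_match {U : Set A} (hN : IsUStructure n N U) (h : ElemEquiv L M N s t)
    (x : Fin n → A) : ∃ y, ElemEquiv L M N x y := by
  by_contra! hcon
  have hsep : ∀ y : Fin n → A, ∃ φ : Formula V n, φ.voc ⊆ L ∧ Sat M φ x ∧ ¬ Sat N φ y := by
    intro y
    have := hcon y
    unfold ElemEquiv at this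
    push Not at this
    obtain ⟨φ, hφ, ⟨h1, h2⟩ | ⟨h1, h2⟩⟩ := this
    · exact ⟨φ, hφ, h1, h2⟩
    · exact ⟨.neg φ, hφ, h1, not_not.2 h2⟩
  choose φ hφ hx hy using hsep
  obtain ⟨Φ, hΦ, hconj⟩ := exists_conj.{u}
    (fun τ : Set.range (simType U (k := n)) => φ τ.2.choose) fun _ => hφ _
  obtain ⟨Ψ, hΨ, hex⟩ := exists_exists.{u} Finset.univ Φ hΦ
  have h1 : Sat M Ψ s := (hex A M s).2 ⟨x, by simp, (hconj A M x).2 fun τ => hx _⟩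
  obtain ⟨y, -, h2⟩ := (hex A N t).1 ((h Ψ hΨ).1 h1)
  let τ : Set.range (simType U (k := n)) := ⟨simType U y, y, rfl⟩
  have h3 := (hconj A N y).1 h2 τ
  have hτ : simType U τ.2.choose = simType U y := τ.2.choose_spec
  exact hy _ ((hN.sat_iff_of_sim _ (simType_eq_iff.1 hτ)).2 h3)

end ElemEquiv

/-! ### Reducts that do not define the core -/

section Undefinable

variable {V : Vocabulary.{v}} {n m : ℕ} {L : Set V.Symb} {A : Type u} {M : RelStructure V A}
  {U : Set A}

theorem DefinableIn.mem_iff_of_sim (hM : IsUStructure n M U) {D : Set (Fin (m + 1) → A)}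
    (hD : DefinableIn n M L D) {d e : Fin (m + 1) → A} (h : Sim U d e) : d ∈ D ↔ e ∈ D := by
  obtain ⟨φ, -, hmn, hφ⟩ := hD
  obtain ⟨r, hr⟩ := (Fin.castLE_injective hmn).hasLeftInverse
  have key : ∀ z : Fin (m + 1) → A, Sat M φ (fun p => z (r p)) ↔ z ∈ D := by
    intro z
    rw [hφ]
    simp only [hr _]
  rw [← key, ← key]
  exact hM.sat_iff_of_sim φ (CrossSim.comp h r)

theorem DefinableIn.exists_last {D : Set (Fin (m + 1) → A)} (hD : DefinableIn n M L D) :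
    DefinableIn n M L {z : Fin m → A | ∃ e, (Fin.snoc z e : Fin (m + 1) → A) ∈ D} := by
  obtain ⟨φ, hφL, hmn, hφ⟩ := hD
  refine ⟨.ex (Fin.castLE hmn (Fin.last m)) φ, hφL, (Nat.le_succ m).trans hmn, fun s => ?_⟩
  refine exists_congr fun a => ?_
  rw [hφ]
  refine iff_of_eq (congrArg (· ∈ D) (funext fun i => ?_))
  refine Fin.lastCases ?_ (fun i => ?_) i
  · simp
  · rw [Fin.snoc_castSucc, update_of_ne]
    · rfl
    · intro hc
      exact (Fin.castSucc_lt_last i).ne (Fin.castLE_injective hmn hc)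

theorem DefinableIn.permute {D : Set (Fin m → A)} (hD : DefinableIn n M L D)
    (π : Equiv.Perm (Fin m)) : DefinableIn n M L {z : Fin m → A | (fun i => z (π i)) ∈ D} := by
  obtain ⟨φ, hφL, hmn, hφ⟩ := hD
  let ρ : Equiv.Perm (Fin n) := π.viaFintypeEmbedding (Fin.castLEEmb hmn)
  refine ⟨φ.rename ρ, (φ.voc_rename ρ).trans_subset hφL, hmn, fun s => ?_⟩
  rw [sat_rename, hφ]
  have h : ∀ i, ρ (Fin.castLE hmn i) = Fin.castLE hmn (π i) := fun i =>
    π.viaFintypeEmbedding_apply_image (Fin.castLEEmb hmn) i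
  simp only [h]
  rfl

/-- If the core is not definable over `L`, then the strong `U`-structure condition reduces
definable relations of pairwise distinct elements to their projections, one place at a time, and
leaves only the empty relation and the relation of all tuples with pairwise distinct entries. -/
theorem IsStrongUStructure.mem_of_injective (hM : IsStrongUStructure n M U)
    (hL : ¬ DefinableIn n M L (unaryRel U)) (m : ℕ) : ∀ D : Set (Fin m → A),
      DefinableIn n M L D → (∀ s ∈ D, Injective s) → D.Nonempty → ∀ s, Injective s → s ∈ D := by
  induction m with
  | zero =>
    rintro D - - ⟨d, hd⟩ s -
    rwa [Subsingleton.elim s d]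
  | succ m ih =>
    rcases m with _ | m
    · rintro D hD - ⟨d, hd⟩ s -
      -- A unary relation that separates `d` from `s` is the core or its complement.
      by_contra hs
      have hsim : ∀ p q : Fin 1 → A, (p 0 ∈ U ↔ q 0 ∈ U) → (p ∈ D ↔ q ∈ D) := fun p q h =>
        hD.mem_iff_of_sim hM.toIsUStructure
          ⟨fun i j => by simp [Fin.fin_one_eq_zero], fun i => by rwa [Fin.fin_one_eq_zero i]⟩
      by_cases hdU : d 0 ∈ U
      · have hsU : s 0 ∉ U := fun h => hs ((hsim d s (iff_of_true hdU h)).1 hd)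
        refine hL (?_ : DefinableIn n M L (unaryRel U))
        rwa [show unaryRel U = D from Set.ext fun t => ?_]
        by_cases ht : t 0 ∈ U
        · exact iff_of_true ht ((hsim d t (iff_of_true hdU ht)).1 hd)
        · exact iff_of_false ht fun h => hs ((hsim t s (iff_of_false ht hsU)).1 h)
      · have hsU : s 0 ∈ U := by
          by_contra h
          exact hs ((hsim d s (iff_of_false hdU h)).1 hd)
        obtain ⟨φ, hφL, h1, hφ⟩ := hD
        refine hL ⟨.neg φ, hφL, h1, fun x => ?_⟩
        refine (not_congr (hφ x)).trans ?_
        generalize (fun i => x (Fin.castLE h1 i)) = t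
        by_cases ht : t 0 ∈ U
        · exact iff_of_true (fun h => hs ((hsim t s (iff_of_true ht hsU)).1 h)) ht
        · exact iff_of_false (not_not.2 ((hsim d t (iff_of_false hdU ht)).1 hd)) ht
    · -- By the induction hypothesis, the projection of `D` along the last place is everything.
      have hlast : ∀ D : Set (Fin (m + 2) → A), DefinableIn n M L D →
          (∀ s ∈ D, Injective s) → D.Nonempty → ∀ b : Fin (m + 2) → A, Injective b →
          ∃ e, update b (Fin.last (m + 1)) e ∈ D := by
        rintro D hD hinj ⟨d, hd⟩ b hb
        obtain ⟨e, he⟩ := ih _ hD.exists_last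
          (by
            rintro z ⟨e, he⟩ i j hij
            have := @hinj _ he i.castSucc j.castSucc
            simp only [Fin.snoc_castSucc] at this
            exact Fin.castSucc_injective _ (this hij))
          ⟨Fin.init d, d (Fin.last _), (Fin.snoc_init_self d).symm ▸ hd⟩
          (Fin.init b) (hb.comp (Fin.castSucc_injective _))
        refine ⟨e, ?_⟩
        convert he using 1
        funext i
        refine Fin.lastCases ?_ (fun i => ?_) i
        · simp
        · rw [Fin.snoc_castSucc, update_of_ne (Fin.castSucc_lt_last i).ne]
          rfl
      intro D hD hinj hne b hb
      have h0 : (0 : Fin (m + 2)) ≠ Fin.last (m + 1) := (Fin.last_pos).ne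
      -- The same for place `0`, by exchanging it with the last place.
      let π : Equiv.Perm (Fin (m + 2)) := Equiv.swap 0 (Fin.last (m + 1))
      have hππ : ∀ i, π (π i) = i := Equiv.swap_apply_self _ _
      refine (hM.strong L hL (m + 2) D hD hinj 0 (Fin.last (m + 1)) h0 b).2
        ⟨?_, hlast D hD hinj hne b hb, hb⟩
      obtain ⟨d, hd⟩ := hne
      obtain ⟨e, he⟩ := hlast _ (hD.permute π)
        (fun z hz i j hij => by
          have := hinj _ hz
          simpa using @this (π i) (π j) (by simpa [hππ] using hij))
        ⟨fun i => d (π i), by simpa [hππ] using hd⟩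
        (fun i => b (π i)) (hb.comp π.injective)
      refine ⟨e, ?_⟩
      have he' : (fun i => update (fun i => b (π i)) (Fin.last (m + 1)) e (π i)) ∈ D := he
      convert he' using 1
      have hl : Fin.last (m + 1) = π 0 := (Equiv.swap_apply_left _ _).symm
      rw [hl]
      refine Eq.trans ?_ (update_comp_eq_of_injective (fun i => b (π i)) π.injective 0 e).symm
      congr 1
      funext i
      simp [hππ]

/-- If the core is not definable over `L`, then formulas over `L` see only the kernel of a
tuple. -/
theorem IsStrongUStructure.elemEquiv_of_kernel_eq (hM : IsStrongUStructure n M U)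
    (hL : ¬ DefinableIn n M L (unaryRel U)) {x y : Fin n → A}
    (hxy : ∀ i j, x i = x j ↔ y i = y j) : ElemEquiv L M M x y := by
  have main : ∀ x y : Fin n → A, (∀ i j, x i = x j ↔ y i = y j) → ∀ φ : Formula V n,
      φ.voc ⊆ L → Sat M φ x → Sat M φ y := by
    intro x y hxy φ hφL hx
    -- `g` sends a place to its block in the kernel of `x`, and `r` chooses a place in each block.
    obtain ⟨m, ⟨e⟩⟩ := Finite.exists_equiv_fin (Set.range x)
    let g : Fin n → Fin m := fun i => e ⟨x i, Set.mem_range_self i⟩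
    have hg : ∀ i j, g i = g j ↔ x i = x j := fun i j => by
      simp [g, e.injective.eq_iff]
    have hgs : Surjective g := by
      intro p
      obtain ⟨i, hi⟩ := (e.symm p).2
      exact ⟨i, by simp [g, hi]⟩
    obtain ⟨r, hr⟩ := hgs.hasRightInverse
    have hrinj : Injective r := hr.injective
    have hmn : m ≤ n := by simpa using Fintype.card_le_of_injective r hrinj
    obtain ⟨π, hπ⟩ : ∃ π : Equiv.Perm (Fin n), ∀ p, π (Fin.castLE hmn p) = r p := by
      let c := Equiv.ofInjective (Fin.castLE hmn) (Fin.castLE_injective hmn)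
      obtain ⟨π, hπ⟩ := Cardinal.extend_function_finite
        (c.symm.toEmbedding.trans ⟨r, hrinj⟩) ⟨Equiv.refl _⟩
      refine ⟨π, fun p => (hπ (c p)).trans ?_⟩
      simp
    -- `φ` restricted to the tuples with the kernel of `x`, as a relation of the `m` block values.
    obtain ⟨ψ, hψL, hψ⟩ := exists_subst.{u} (fun i => r (g i)) (fun i => by rw [hr]) φ hφL
    obtain ⟨δ, hδL, hδ⟩ := exists_conj.{u} (L := L)
      (fun p : {p : Fin m × Fin m // p.1 ≠ p.2} =>
        Formula.neg (.eq (V := V) (Fin.castLE hmn p.1.1) (Fin.castLE hmn p.1.2)))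
      fun _ => Set.empty_subset _
    let D : Set (Fin m → A) := {z | Injective z ∧ Sat M φ fun i => z (g i)}
    have hD : DefinableIn n M L D := by
      refine ⟨.and δ (ψ.rename π⁻¹),
        Set.union_subset hδL ((ψ.voc_rename _).trans_subset hψL), hmn, fun s => ?_⟩
      have h1 : ∀ p, π⁻¹ (r p) = Fin.castLE hmn p := fun p => by
        rw [← hπ]
        exact π.symm_apply_apply _
      simp only [Sat, hδ, sat_rename, hψ, h1, Subtype.forall, Prod.forall]
      refine and_congr_left fun _ => ?_
      exact ⟨fun h p q hpq => by_contra fun hne => h p q hne hpq,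
        fun h p q hne hpq => hne (h hpq)⟩
    have hxr : (fun i => x (r (g i))) = x := funext fun i => (hg _ _).1 (hr (g i))
    have hyr : (fun i => y (r (g i))) = y := funext fun i => (hxy _ _).1 ((hg _ _).1 (hr (g i)))
    have hxD : (fun p => x (r p)) ∈ D := by
      refine ⟨fun p q h => ?_, ?_⟩
      · rw [← hr p, ← hr q]
        exact (hg _ _).2 h
      · exact hxr.symm ▸ hx
    have hyinj : Injective fun p => y (r p) := fun p q h => by
      rw [← hr p, ← hr q]
      exact (hg _ _).2 ((hxy _ _).2 h)
    have := (hM.mem_of_injective hL m D hD (fun _ h => h.1) ⟨_, hxD⟩ _ hyinj).2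
    rwa [hyr] at this
  exact fun φ hφ => ⟨main x y hxy φ hφ, main y x (fun i j => (hxy i j).symm) φ hφ⟩

end Undefinable

/-! ### Implicit definability and equivalence over the sub-vocabulary -/

section Implicit

variable {V : Vocabulary.{v}} {n : ℕ} {L : Set V.Symb}

/-- The image of a structure under a permutation of its universe. -/
def transport {A : Type u} (σ : Equiv.Perm A) (M : RelStructure V A) : RelStructure V A :=
  fun _ => {x | (fun i => σ.symm (x i)) ∈ M _}

section Transport

variable {A : Type u} {M : RelStructure V A} {U : Set A}

theorem IsUStructure.matches_transport (hM : IsUStructure n M U) (σ : Equiv.Perm A) :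
    Matches n U (σ.symm ⁻¹' U) M (transport σ M) := fun S f s x h =>
  hM.matches_self S f s (fun i => σ.symm (x i))
    ⟨fun i j => (h.1 i j).trans σ.symm.injective.eq_iff.symm, h.2⟩

theorem IsUStructure.transport (hM : IsUStructure n M U) (σ : Equiv.Perm A) :
    IsUStructure n (transport σ M) (σ.symm ⁻¹' U) where
  nonempty := hM.nonempty
  card_core := by
    rw [Set.encard_preimage_of_bijective σ.symm.bijective]
    exact hM.card_core
  card_compl := by
    rw [← Set.preimage_compl, Set.encard_preimage_of_bijective σ.symm.bijective]
    exact hM.card_compl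
  invariant := fun S s z hs h => hM.invariant S _ _ hs
    ⟨fun i j => by simpa using h.1 i j, h.2⟩

theorem IsUStructure.sat_transport_iff (hM : IsUStructure n M U) (σ : Equiv.Perm A)
    (φ : Formula V n) (s : Fin n → A) :
    Sat (UnLogic.transport σ M) φ (fun i => σ (s i)) ↔ Sat M φ s :=
  ((hM.matches_transport σ).sat_iff hM.spacious (hM.transport σ).spacious φ s _
    ⟨fun i j => by simp, fun i => by simp⟩).symm

theorem IsStrongUStructure.modelsTheory_transport {T : Set (Formula V n)}
    (hM : IsStrongUStructure n M U) (hT : ∀ φ ∈ T, ∀ s, Sat M φ s) (σ : Equiv.Perm A) :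
    ModelsTheory (UnLogic.transport σ M) T :=
  have hσ := hM.toIsUStructure.transport σ
  have hm := hM.toIsUStructure.matches_transport σ
  ⟨⟨_, hM.transfer hσ hm⟩, fun φ hφ => (hm.valid_iff hM.spacious hσ.spacious φ).1 (hT φ hφ)⟩

end Transport

variable {T : Set (Formula V n)} {M N : RelStructure V Base.{u}}

/-- Implicit definability applied to the image of `M` under a permutation that preserves
everything expressible over `L`; normality of `M` and `N` makes their `L`-reducts agree also at the
tuples with more than `n` distinct entries. -/
theorem NormalModel.sat_iff_of_forall_elemEquiv (himp : ImplicitlyDefines.{u} T L)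
    (hM : NormalModel T M) (hN : NormalModel T N) (σ : Equiv.Perm Base.{u})
    (h : ∀ x : Fin n → Base.{u}, ElemEquiv L M N x fun i => σ (x i)) (φ : Formula V n)
    (s : Fin n → Base.{u}) : Sat M φ s ↔ Sat N φ fun i => σ (s i) := by
  -- The core of the image of `M` may differ from that of `N`.
  have hMN : transport σ M = N := by
    refine himp _ _ _ (hM.strong.modelsTheory_transport hM.valid σ) hN.modelsTheory ?_
    intro S hS
    have key : ∀ (f : Fin (V.arity S) → Fin n) (y : Fin n → Base.{u}),
        (fun i => y (f i)) ∈ M S ↔ (fun i => σ (y (f i))) ∈ N S := fun f y =>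
      h y (.rel S f) (Set.singleton_subset_iff.2 hS)
    ext x
    constructor
    · intro hx
      obtain ⟨f, y, hy⟩ := (hM.few S _ hx).exists_eq_comp
      have hx' : (fun i => σ (y (f i))) ∈ N S := by
        rw [← key, ← hy]
        exact hx
      convert hx' using 1
      funext i
      rw [← congrFun hy i, Equiv.apply_symm_apply]
    · intro hx
      obtain ⟨f, y, rfl⟩ := (hN.few S _ hx).exists_eq_comp
      exact (key f fun i => σ.symm (y i)).2 (by simpa using hx)
  rw [← hMN, hM.strong.sat_transport_iff]

theorem not_definableIn_core_of_const (h : ∀ a b : Base.{u},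
    ElemEquiv L M M (fun _ : Fin n => a) (fun _ => b)) :
    ¬ DefinableIn n M L (unaryRel core) := by
  rintro ⟨υ, hυL, h1, hυ⟩
  have := (hυ _).symm.trans ((h ⟨(0, true)⟩ ⟨(0, false)⟩ υ hυL).trans (hυ _))
  simp [unaryRel, core] at this

theorem IsUStructure.elemEquiv_of_sim {A : Type u} {M : RelStructure V A} {U : Set A}
    (hM : IsUStructure n M U) {s z : Fin n → A} (h : Sim U s z) : ElemEquiv L M M s z :=
  fun φ _ => hM.sat_iff_of_sim φ h

theorem IsUStructure.elemEquiv_const (hM : IsUStructure n M core) {a b : Base.{u}}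
    (h : a ∈ core ↔ b ∈ core) : ElemEquiv L M M (fun _ : Fin n => a) (fun _ => b) :=
  hM.elemEquiv_of_sim ⟨fun _ _ => by simp, fun _ => h⟩

/-- If formulas over `L` can tell some two elements apart, then they can tell the core from its
complement. -/
theorem IsUStructure.core_iff_of_elemEquiv_const (hM : IsUStructure n M core) {a b c d : Base.{u}}
    (hab : ¬ ElemEquiv L M M (fun _ : Fin n => a) (fun _ => b))
    (h : ElemEquiv L M M (fun _ : Fin n => c) (fun _ => d)) : c ∈ core ↔ d ∈ core := by
  by_contra hcd
  apply hab
  have hdisj : ((a ∈ core ↔ c ∈ core) ∨ (a ∈ core ↔ d ∈ core)) ∧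
      ((b ∈ core ↔ c ∈ core) ∨ (b ∈ core ↔ d ∈ core)) := by tauto
  obtain ⟨h1 | h1, h2 | h2⟩ := hdisj
  · exact (hM.elemEquiv_const h1).trans (hM.elemEquiv_const h2.symm)
  · exact (hM.elemEquiv_const h1).trans (h.trans (hM.elemEquiv_const h2.symm))
  · exact (hM.elemEquiv_const h1).trans (h.symm.trans (hM.elemEquiv_const h2.symm))
  · exact (hM.elemEquiv_const h1).trans (hM.elemEquiv_const h2.symm)

theorem exists_perm_of_kernel_eq {s t : Fin n → Base.{u}} (h : ∀ i j, s i = s j ↔ t i = t j) :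
    ∃ σ : Equiv.Perm Base.{u}, ∀ i, σ (s i) = t i := by
  have hch : ∀ a : Set.range s, s a.2.choose = a := fun a => a.2.choose_spec
  let e : Set.range s ↪ Base.{u} := ⟨fun a => t a.2.choose, fun a b hab => by
    rw [Subtype.ext_iff, ← hch a, ← hch b]
    exact (h _ _).2 hab⟩
  obtain ⟨σ, hσ⟩ := Cardinal.extend_function_of_lt e
    ((Cardinal.lt_aleph0_of_finite _).trans_le (Cardinal.aleph0_le_mk Base.{u})) ⟨Equiv.refl _⟩
  exact ⟨σ, fun i => (hσ ⟨s i, i, rfl⟩).trans ((h _ _).1 (hch ⟨s i, i, rfl⟩))⟩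

/-- A constant tuple has a constant partner, since equivalent tuples have the same kernel. -/
theorem ElemEquiv.exists_const_match (hN : IsUStructure n N core) {s t : Fin n → Base.{u}}
    (h : ElemEquiv L M N s t) (a : Base.{u}) :
    ∃ b : Base.{u}, ElemEquiv L M N (fun _ : Fin n => a) (fun _ => b) := by
  obtain ⟨y, hy⟩ := h.exists_match hN fun _ => a
  rcases n with _ | n
  · exact ⟨a, Subsingleton.elim y (fun _ => a) ▸ hy⟩
  · refine ⟨y 0, ?_⟩
    rwa [← show y = fun _ => y 0 from funext fun i => (hy.eq_iff i 0).1 rfl]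

/-- The case in which formulas over `L` can tell some two elements of `M` apart. Up to exchanging
the core with its complement, `M` and `N` agree over `L`. -/
theorem exists_perm_of_not_elemEquiv_const (hM : IsUStructure n M core)
    (hN : IsUStructure n N core) {s t : Fin n → Base.{u}} (h : ElemEquiv L M N s t)
    {a b : Base.{u}} (hab : ¬ ElemEquiv L M M (fun _ : Fin n => a) (fun _ => b)) :
    ∃ σ : Equiv.Perm Base.{u}, ∀ x y : Fin n → Base.{u}, ElemEquiv L M N x y →
      Sim core y fun i => σ (x i) := by
  obtain ⟨a', ha⟩ := h.exists_const_match hN a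
  obtain ⟨b', hb⟩ := h.exists_const_match hN b
  have hab' : ¬ ElemEquiv L N N (fun _ : Fin n => a') (fun _ => b') := fun hc =>
    hab (ha.trans (hc.trans hb.symm))
  have hcol : ¬ (a ∈ core ↔ b ∈ core) := fun hc => hab (hM.elemEquiv_const hc)
  have hcol' : ¬ (a' ∈ core ↔ b' ∈ core) := fun hc => hab' (hN.elemEquiv_const hc)
  obtain ⟨σ, hσ⟩ : ∃ σ : Equiv.Perm Base.{u},
      ∀ c, (σ c ∈ core ↔ a' ∈ core) ↔ (c ∈ core ↔ a ∈ core) := by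
    by_cases haa : a ∈ core ↔ a' ∈ core
    · exact ⟨Equiv.refl _, fun c => by rw [haa]; rfl⟩
    · refine ⟨colourSwap, fun c => ?_⟩
      rw [colourSwap_mem_core]
      tauto
  have hconst : ∀ c, ElemEquiv L M N (fun _ : Fin n => c) (fun _ => σ c) := by
    intro c
    by_cases hc : c ∈ core ↔ a ∈ core
    · exact (hM.elemEquiv_const hc).trans (ha.trans (hN.elemEquiv_const ((hσ c).2 hc).symm))
    · have h1 : c ∈ core ↔ b ∈ core := by tauto
      have h2 : b' ∈ core ↔ σ c ∈ core := by
        have := hσ c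
        tauto
      exact (hM.elemEquiv_const h1).trans (hb.trans (hN.elemEquiv_const h2))
  refine ⟨σ, fun x y hxy => ⟨fun i j => ?_, fun i => ?_⟩⟩
  · rw [σ.injective.eq_iff]
    exact (hxy.eq_iff i j).symm
  · exact hN.core_iff_of_elemEquiv_const hab' ((hxy.const i).symm.trans (hconst (x i)))

/-- Under implicit definability, the formulas over `L` that a tuple satisfies in a normal model
determine all formulas that it satisfies. -/
theorem NormalModel.sat_iff_of_elemEquiv (himp : ImplicitlyDefines.{u} T L)
    (hM : NormalModel T M) (hN : NormalModel T N) {s t : Fin n → Base.{u}}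
    (h : ElemEquiv L M N s t) (φ : Formula V n) : Sat M φ s ↔ Sat N φ t := by
  have hMu := hM.strong.toIsUStructure
  have hNu := hN.strong.toIsUStructure
  by_cases hc : ∀ a b : Base.{u}, ElemEquiv L M M (fun _ : Fin n => a) (fun _ => b)
  · have hc' : ∀ a b : Base.{u}, ElemEquiv L N N (fun _ : Fin n => a) (fun _ => b) := by
      intro a b
      obtain ⟨a', ha⟩ := h.symm.exists_const_match hMu a
      obtain ⟨b', hb⟩ := h.symm.exists_const_match hMu b
      exact ha.trans ((hc a' b').trans hb.symm)
    have hNk : ∀ x y : Fin n → Base.{u}, (∀ i j, x i = x j ↔ y i = y j) → ElemEquiv L N N x y :=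
      fun x y => hN.strong.elemEquiv_of_kernel_eq (not_definableIn_core_of_const hc')
    obtain ⟨σ, hσ⟩ := exists_perm_of_kernel_eq h.eq_iff
    have := hM.sat_iff_of_forall_elemEquiv himp hN σ (fun x => by
      obtain ⟨y, hy⟩ := h.exists_match hNu x
      exact hy.trans (hNk _ _ fun i j => by rw [σ.injective.eq_iff, hy.eq_iff])) φ s
    simpa only [hσ] using this
  · push Not at hc
    obtain ⟨a, b, hab⟩ := hc
    obtain ⟨σ, hσ⟩ := exists_perm_of_not_elemEquiv_const hMu hNu h hab
    rw [hM.sat_iff_of_forall_elemEquiv himp hN σ (fun x => by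
      obtain ⟨y, hy⟩ := h.exists_match hNu x
      exact hy.trans (hNu.elemEquiv_of_sim (hσ x y hy))) φ s]
    exact (hNu.sat_iff_of_sim φ (hσ s t h)).symm

end Implicit

/-! ### One defining formula for all models -/

section Uniform

variable {V : Vocabulary.{v}} {n : ℕ} {L : Set V.Symb} {T : Set (Formula V n)}
  {ρ : Formula V n}

/-- Compactness, applied to the formulas over `L` that a tuple satisfies. -/
theorem exists_formula_implying
    (hρ : ∀ M N : RelStructure V Base.{u}, NormalModel T M → NormalModel T N →
      ∀ s t, ElemEquiv L M N s t → Sat M ρ s → Sat N ρ t)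
    {M : RelStructure V Base.{u}} (hM : NormalModel T M) {s : Fin n → Base.{u}}
    (hs : Sat M ρ s) :
    ∃ θ : Formula V n, θ.voc ⊆ L ∧ Sat M θ s ∧
      ∀ N : RelStructure V Base.{u}, NormalModel T N → ∀ t, Sat N θ t → Sat N ρ t := by
  by_contra! hcon
  obtain ⟨N, hN, t, ht⟩ := NormalModel.compactness.{u} (T := T)
    (Γ := insert (.neg ρ) {θ | θ.voc ⊆ L ∧ Sat M θ s}) (by
      intro Γ₀ hfin hsub
      have : Finite {θ // θ ∈ Γ₀ ∩ {θ | θ.voc ⊆ L ∧ Sat M θ s}} :=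
        (hfin.inter_of_left _).to_subtype
      obtain ⟨Θ, hΘ, hconj⟩ := exists_conj.{u} (L := L)
        (fun θ : {θ // θ ∈ Γ₀ ∩ {θ | θ.voc ⊆ L ∧ Sat M θ s}} => θ.1) fun θ => θ.2.2.1
      obtain ⟨N, hN, t, h1, h2⟩ := hcon Θ hΘ ((hconj _ _ _).2 fun θ => θ.2.2.2)
      refine ⟨N, hN, t, fun γ hγ => ?_⟩
      rcases hsub hγ with rfl | hγ'
      · exact h2
      · exact (hconj _ _ _).1 h1 ⟨γ, hγ, hγ'⟩)
  refine ht _ (Set.mem_insert _ _) (hρ M N hM hN s t (fun φ hφ => ?_) hs)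
  by_cases h : Sat M φ s
  · exact iff_of_true h (ht _ (Set.mem_insert_of_mem _ ⟨hφ, h⟩))
  · exact iff_of_false h (ht (.neg φ) (Set.mem_insert_of_mem _ ⟨hφ, h⟩))

/-- A formula that is invariant under equivalence over `L` is expressible over `L`, uniformly in
all normal models. -/
theorem exists_formula_iff
    (hρ : ∀ M N : RelStructure V Base.{u}, NormalModel T M → NormalModel T N →
      ∀ s t, ElemEquiv L M N s t → Sat M ρ s → Sat N ρ t) :
    ∃ φ : Formula V n, φ.voc ⊆ L ∧
      ∀ N : RelStructure V Base.{u}, NormalModel T N → ∀ t, Sat N φ t ↔ Sat N ρ t := by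
  by_contra! hcon
  let G : Set (Formula V n) := {θ | θ.voc ⊆ L ∧
    ∀ N : RelStructure V Base.{u}, NormalModel T N → ∀ t, Sat N θ t → Sat N ρ t}
  obtain ⟨M, hM, s, hs⟩ := NormalModel.compactness.{u} (T := T)
    (Γ := insert ρ (Formula.neg '' G)) (by
      intro Γ₀ hfin hsub
      have : Finite {θ // θ ∈ Formula.neg ⁻¹' Γ₀ ∩ G} :=
        ((hfin.preimage fun _ _ _ _ h => Formula.neg.inj h).inter_of_left _).to_subtype
      obtain ⟨Θ, hΘ, hdisj⟩ := exists_disj.{u} (L := L)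
        (fun θ : {θ // θ ∈ Formula.neg ⁻¹' Γ₀ ∩ G} => θ.1) fun θ => θ.2.2.1
      obtain ⟨N, hN, t, h⟩ := hcon Θ hΘ
      have himpl : Sat N Θ t → Sat N ρ t := fun h' => by
        obtain ⟨θ, hθ⟩ := (hdisj _ _ _).1 h'
        exact θ.2.2.2 N hN t hθ
      have h1 : Sat N ρ t := by tauto
      have h2 : ¬ Sat N Θ t := by tauto
      refine ⟨N, hN, t, fun γ hγ => ?_⟩
      rcases hsub hγ with rfl | ⟨θ, hθ, rfl⟩
      · exact h1
      · exact fun h3 => h2 ((hdisj _ _ _).2 ⟨⟨θ, hγ, hθ⟩, h3⟩))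
  obtain ⟨θ, hθL, hθ, himpl⟩ := exists_formula_implying hρ hM (hs ρ (Set.mem_insert _ _))
  exact hs (.neg θ) (Set.mem_insert_of_mem _ ⟨θ, ⟨hθL, himpl⟩, rfl⟩) hθ

end Uniform

/-! ### Symbols of large arity -/

/-- If the arity of `R` exceeds `n`, then the `n` variables do not see whether `R` contains the
tuples with more than `n` distinct entries. So a theory that implicitly defines `R` has no
models. -/
theorem not_modelsTheory_of_lt_arity {V : Vocabulary.{v}} {n : ℕ} {L : Set V.Symb} {R : V.Symb}
    (hR : R ∉ L) {T : Set (Formula V n)} (himp : ImplicitlyDefines.{u} T L)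
    (hn : n < V.arity R) {A : Type u} (M : RelStructure V A) : ¬ ModelsTheory M T := by
  rintro ⟨⟨U, hM⟩, hT⟩
  have hN := normalModel_normalize hM hT
  set N := normalize n M U
  let N' : RelStructure V Base.{u} := fun S => {x | x ∈ N S ∨ S = R ∧ ¬ FewValues n x}
  have hu : IsUStructure n N' core := by
    refine ⟨⟨⟨(0, true)⟩⟩, (spacious_core n).1, (spacious_core n).2, ?_⟩
    rintro S s z (hs | ⟨hS, hs⟩) hsz
    · exact Or.inl (hN.strong.invariant S s z hs hsz)
    · refine Or.inr ⟨hS, fun hz => hs ?_⟩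
      obtain ⟨f, hf⟩ := hz
      exact ⟨f, fun i j h => (hsz.1 i j).2 (hf i j h)⟩
  have hm : Matches n core core N N' := fun S f s x h =>
    (hN.strong.matches_self S f s x h).trans
      ⟨Or.inl, fun h' => h'.resolve_right fun h'' => h''.2 (fewValues_comp x f)⟩
  have heq : N = N' := himp _ _ _ hN.modelsTheory
    ⟨⟨core, hN.strong.transfer hu hm⟩, fun φ hφ =>
      (hm.valid_iff (spacious_core n) (spacious_core n) φ).1 (hN.valid φ hφ)⟩
    fun S hS => Set.ext fun x =>
      ⟨Or.inl, fun h => h.resolve_right fun h' => hR (h'.1 ▸ hS)⟩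
  let x : Fin (V.arity R) → Base.{u} := fun i => ⟨(i, true)⟩
  have hx : ¬ FewValues n x := by
    rintro ⟨f, hf⟩
    have hinj : Injective f := fun i j h => by simpa [x, Fin.ext_iff] using hf i j h
    have := Fintype.card_le_of_injective f hinj
    simp only [Fintype.card_fin] at this
    omega
  have hxN : x ∈ N R := by
    rw [heq]
    exact Or.inr ⟨rfl, hx⟩
  exact hx (hN.few R x hxN)

end UnLogic

open UnLogic in
theorem theorem4p3 (n : ℕ) : UnLogic.BethDefinabilityProperty.{u, v} n := by
  intro V L R hR T himp
  rcases lt_or_ge n (V.arity R) with hn | hn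
  · exact ⟨.falsum, Set.empty_subset _, fun A M hM =>
      absurd hM (not_modelsTheory_of_lt_arity (fun h => (hR R).2 rfl h) himp hn M)⟩
  · let ρ : Formula V n := .rel R (Fin.castLE hn)
    obtain ⟨φ, hφL, hφ⟩ := exists_formula_iff.{u} (ρ := ρ)
      fun M N hM hN s t h => (hM.sat_iff_of_elemEquiv himp hN h ρ).1
    refine ⟨φ, hφL, ?_⟩
    rintro A M ⟨⟨U, hM⟩, hT⟩
    have hsat := (matches_normalize hM.toIsUStructure).sat_iff hM.spacious (spacious_core n)
    refine ⟨hn, fun s => ?_⟩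
    obtain ⟨x, hx⟩ := exists_crossSim hM.spacious (spacious_core.{u} n) s
    rw [hsat φ s x hx, hφ _ (normalModel_normalize hM hT)]
    exact (hsat ρ s x hx).symm
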